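/- Let $n\ge 1$ and $r>0$, and let $S_r^{2n-1}=\{\omega\in\mathbb C^n:|\omega|=r\}$. Let $\mathcal C\subseteq\mathbb C^n$ be a complex cone (that is, $\lambda\mathcal C\subseteq\mathcal C$ for all $\lambda\in\mathbb C$) which is non-harmonic, i.e. not contained in the zero set of any nonzero homogeneous harmonic polynomial $P(z)=\sum_{\alpha,\beta}c_{\alpha\beta}z^\alpha\bar z^\beta$ (with complex coefficients, homogeneous and harmonic on $\mathbb C^n=\mathbb R^{2n}$). Let $\mu$ be a finite complex Borel measure on $\mathbb C^n$ which is supported on $S_r^{2n-1}$ and absolutely continuous with respect to the surface measure of $S_r^{2n-1}$. For $k\in\mathbb Z_+=\{0,1,2,\dots\}$ put $$\varphi_k^{n-1}(z)=L_k^{n-1}\!\left(\tfrac{|z|^2}{2}\right)e^{-|z|^2/4},\qquad L_k^{n-1}(x)=\sum_{j=0}^k\binom{n-1+k}{k-j}\frac{(-x)^j}{j!},$$ and let the spectral projections of $\mu$ be $$\varphi_k^{n-1}\times\mu(z)=\int_{S_r^{2n-1}}\varphi_k^{n-1}(z-\omega)\,e^{\frac i2\operatorname{Im}(z\cdot\bar\omega)}\,d\mu(\omega),\qquad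 z\in\mathbb C^n,$$ where $z\cdot\bar\omega=\sum_{j=1}^n z_j\bar\omega_j$. If $\varphi_k^{n-1}\times\mu(z)=0$ for every $z\in\mathcal C$ and every $k\in\mathbb Z_+$, then $\mu=0$. -/

import Mathlib

open MeasureTheory
open scoped ENNReal

noncomputable section

namespace SpectralProjection

/-- The space `ℂⁿ` with its Euclidean (Hermitian) norm. -/
abbrev CSpace (n : ℕ) : Type := EuclideanSpace ℂ (Fin n)

/-! ### Cones and harmonic polynomials -/

/-- A set `C ⊆ ℂⁿ` is a complex cone if `l • C ⊆ C` for every `l ∈ ℂ`. -/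
def IsComplexCone {n : ℕ} (C : Set (CSpace n)) : Prop :=
  ∀ l : ℂ, ∀ z ∈ C, l • z ∈ C

/-- Complex-valued polynomials on `ℂⁿ = ℝ²ⁿ`, written in the `2n` variables `z_j` (`Sum.inl j`)
and `\bar z_j` (`Sum.inr j`), i.e. `P(z) = ∑ c_{αβ} z^α \bar z^β`. -/
abbrev ZPoly (n : ℕ) : Type := MvPolynomial (Fin n ⊕ Fin n) ℂ

/-- The value `P(z) = ∑ c_{αβ} z^α \bar z^β`. -/
def ZPoly.value {n : ℕ} (P : ZPoly n) (z : CSpace n) : ℂ :=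
  MvPolynomial.eval (Sum.elim (fun j => z j) (fun j => (starRingEnd ℂ) (z j))) P

/-- The Euclidean Laplacian of `ℝ²ⁿ` in complex coordinates: since
`∂²/∂x_j² + ∂²/∂y_j² = 4 ∂²/∂z_j∂\bar z_j`, it is `Δ = 4 ∑_j ∂²/∂z_j∂\bar z_j`. -/
def ZPoly.laplacian {n : ℕ} (P : ZPoly n) : ZPoly n :=
  MvPolynomial.C 4 *
    ∑ j : Fin n, MvPolynomial.pderiv (Sum.inl j) (MvPolynomial.pderiv (Sum.inr j) P)

/-- `P` is a nonzero homogeneous harmonic polynomial of degree `l`. -/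
structure IsHomogeneousHarmonic {n : ℕ} (P : ZPoly n) (l : ℕ) : Prop where
  ne_zero : P ≠ 0
  homogeneous : P.IsHomogeneous l
  harmonic : P.laplacian = 0

/-- A set is non-harmonic if it is not contained in the zero set of any (nonzero) homogeneous
harmonic polynomial. -/
def IsNonHarmonic {n : ℕ} (C : Set (CSpace n)) : Prop :=
  ∀ (l : ℕ) (P : ZPoly n), IsHomogeneousHarmonic P l → ¬ C ⊆ {z | P.value z = 0}

/-! ### Laguerre functions -/

/-- The Laguerre polynomial `L_k^a(x) = ∑_{j=0}^k binom(a+k, k-j) (-x)^j / j!`, for `a ∈ ℕ`. -/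
def laguerrePoly (a k : ℕ) (x : ℝ) : ℝ :=
  ∑ j ∈ Finset.range (k + 1), ((a + k).choose (k - j) : ℝ) * (-x) ^ j / (j.factorial : ℝ)

/-- The Laguerre function `φ_k^a(z) = L_k^a(|z|²/2) e^{-|z|²/4}` on `ℂⁿ`. -/
def laguerreFun {n : ℕ} (a k : ℕ) (z : CSpace n) : ℝ :=
  laguerrePoly a k (‖z‖ ^ 2 / 2) * Real.exp (-‖z‖ ^ 2 / 4)

/-! ### Measures on spheres and their spectral projections -/

/-- The surface measure of the sphere of radius `r` centred at the origin of `ℂⁿ = ℝ²ⁿ`, as a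
measure on `ℂⁿ`: the image of the surface measure of the unit sphere under `ω ↦ r ω`, multiplied
by `r^{2n-1}`. -/
def surfaceMeasure (n : ℕ) (r : ℝ) : Measure (CSpace n) :=
  ENNReal.ofReal (r ^ (2 * n - 1)) •
    ((volume : Measure (CSpace n)).toSphere).map
      (fun ω : Metric.sphere (0 : CSpace n) 1 => r • (ω : CSpace n))

/-- The space `X(S_r)` of all finite complex Borel measures on `ℂⁿ` which are supported on the
sphere of radius `r` and absolutely continuous with respect to its surface measure. -/
structure MemX {n : ℕ} (r : ℝ) (μ : ComplexMeasure (CSpace n)) : Prop where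
  supported : ∀ A : Set (CSpace n), MeasurableSet A →
    Disjoint A (Metric.sphere (0 : CSpace n) r) → μ A = 0
  absolutelyContinuous :
    VectorMeasure.AbsolutelyContinuous μ (surfaceMeasure n r).toENNRealVectorMeasure

/-- The imaginary part of `z · \bar w = ∑_j z_j \bar w_j`. -/
def imDot {n : ℕ} (z w : CSpace n) : ℝ :=
  (∑ j : Fin n, z j * (starRingEnd ℂ) (w j)).im

/-- The spectral projection of a complex measure `μ` living on the sphere `S_r`:
`(φ_k^{n-1} × μ)(z) = ∫_{S_r} φ_k^{n-1}(z - ω) e^{(i/2) Im(z · \bar ω)} dμ(ω)`. The integral against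
the complex measure `μ` pairs complex values by multiplication. -/
def spectralProjection {n : ℕ} (r : ℝ) (k : ℕ) (μ : ComplexMeasure (CSpace n))
    (z : CSpace n) : ℂ :=
  VectorMeasure.integral (VectorMeasure.restrict μ (Metric.sphere (0 : CSpace n) r))
    (fun ω : CSpace n =>
      (laguerreFun (n - 1) k (z - ω) : ℂ) * Complex.exp (Complex.I / 2 * (imDot z ω : ℂ)))
    (ContinuousLinearMap.mul ℝ ℂ)

end SpectralProjection

end

/-!
Write `q(ω) = |z - ω|² / 2` and `g(ω) = e^{-q(ω)/2} e^{(i/2) Im(z · ω̄)}`. The kernels are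
`L_k(q) g` and `L_k` has degree exactly `k`, so if all projections vanish at `z`, then `μ`
annihilates every `q^k g`. Hence it annihilates `e^{q/2} g = e^{(i/2) Im(z · ω̄)}`, that is, the
Fourier transform of `μ` vanishes on the cone.

Put `h_z(ω) = z · ω̄`. Replacing `z` by `l z` with `l ∈ ℂ` and expanding in `l` and `l̄` shows that
all moments `∫ h_z^j h̄_z^m dμ` vanish for `z` in the cone. As functions of `z` and `z̄` they are
homogeneous polynomials, and on the sphere the Laplacian of the `(j, m)` moment is
`4 r² j m` times the `(j - 1, m - 1)` moment. By induction on `j` each moment is harmonic, hence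
zero because the cone is non-harmonic. So all moments vanish identically, the Fourier transform of
`μ` is zero, and `μ = 0`.
-/

namespace SpectralProjection

section VectorMeasure

open ContinuousLinearMap

variable {X E F F' G : Type*} [MeasurableSpace X] [NormedAddCommGroup E]
  [NormedAddCommGroup F] [NormedSpace ℝ F] [NormedAddCommGroup F'] [NormedSpace ℝ F']

theorem variation_mapRange_le (μ : VectorMeasure X F) (L : F →L[ℝ] F') :
    (μ.mapRange (L : F →ₗ[ℝ] F').toAddMonoidHom L.continuous).variation ≤ ‖L‖₊ • μ.variation := by
  refine VectorMeasure.variation_le_of_forall_enorm_le fun A _ => ?_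
  calc ‖L (μ A)‖ₑ ≤ ‖L‖ₑ * ‖μ A‖ₑ := L.le_opENorm _
    _ ≤ ‖L‖ₑ * μ.variation A := by gcongr; exact μ.enorm_measure_le_variation A

theorem integrable_mapRange {μ : VectorMeasure X F} {f : X → E} (hf : μ.Integrable f)
    (L : F →L[ℝ] F') :
    (μ.mapRange (L : F →ₗ[ℝ] F').toAddMonoidHom L.continuous).Integrable f :=
  (Integrable.smul_measure_nnreal hf).mono_measure (variation_mapRange_le μ L)

variable [NormedSpace ℝ E] [NormedAddCommGroup G] [NormedSpace ℝ G]

theorem integral_congr_transpose {μ : VectorMeasure X F} {ν : VectorMeasure X F'} {f : X → E}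
    {B : E →L[ℝ] F →L[ℝ] G} {B' : E →L[ℝ] F' →L[ℝ] G}
    (hμ : μ.Integrable f) (hν : ν.Integrable f) (h : μ.transpose B = ν.transpose B') :
    μ.integral f B = ν.integral f B' := by
  rw [VectorMeasure.integral_eq_setToFun_transpose hμ,
    VectorMeasure.integral_eq_setToFun_transpose hν]
  congr!

theorem integral_mapRange {μ : VectorMeasure X F} {f : X → E} (hf : μ.Integrable f)
    (L : F →L[ℝ] F') (B : E →L[ℝ] F' →L[ℝ] G) :
    (μ.mapRange (L : F →ₗ[ℝ] F').toAddMonoidHom L.continuous).integral f B =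
      μ.integral f (B.bilinearComp (.id ℝ E) L) :=
  integral_congr_transpose (integrable_mapRange hf L) hf rfl

/-- The pullback of a vector measure along a measurable embedding. -/
noncomputable def comapEmbedding {Y M : Type*} [MeasurableSpace Y] [AddCommMonoid M]
    [TopologicalSpace M] (μ : VectorMeasure X M) {φ : Y → X} (hφ : MeasurableEmbedding φ) :
    VectorMeasure Y M := by
  classical exact
  { measureOf' A := if MeasurableSet A then μ (φ '' A) else 0
    empty' := by simp
    not_measurable' _ hA := if_neg hA
    m_iUnion' A hA hd := by
      simp only [hA, MeasurableSet.iUnion hA, if_true, Set.image_iUnion]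
      exact μ.m_iUnion (fun i => hφ.measurableSet_image' (hA i)) fun i j hij =>
        (Set.disjoint_image_iff hφ.injective).2 (hd hij) }

theorem map_comapEmbedding {Y M : Type*} [MeasurableSpace Y] [AddCommMonoid M]
    [TopologicalSpace M] (μ : VectorMeasure X M) {φ : Y → X} (hφ : MeasurableEmbedding φ) :
    (comapEmbedding μ hφ).map φ = μ.restrict (Set.range φ) := by
  ext1 A hA
  rw [VectorMeasure.map_apply _ hφ.measurable hA,
    VectorMeasure.restrict_apply _ hφ.measurableSet_range hA, ← Set.image_preimage_eq_inter_range]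
  exact if_pos (hφ.measurable hA)

theorem restrict_eq_self_of_supported {M : Type*} [AddCommGroup M] [TopologicalSpace M] [T2Space M]
    (μ : VectorMeasure X M) {S : Set X} (hS : MeasurableSet S)
    (h : ∀ A, MeasurableSet A → Disjoint A S → μ A = 0) : μ.restrict S = μ := by
  ext1 A hA
  rw [VectorMeasure.restrict_apply _ hS hA,
    ← VectorMeasure.of_add_of_sdiff (hA.inter hS) hA Set.inter_subset_left, Set.sdiff_self_inter,
    h (A \ S) (hA.diff hS) Set.disjoint_sdiff_left, add_zero]

theorem integral_signedMeasure_eq_sub (s : SignedMeasure X) {f : X → E} (hf : s.Integrable f) :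
    s.integral f (lsmul ℝ ℝ).flip =
      ∫ x, f x ∂s.toJordanDecomposition.posPart - ∫ x, f x ∂s.toJordanDecomposition.negPart := by
  rw [VectorMeasure.Integrable, ← SignedMeasure.totalVariation_eq_variation] at hf
  obtain ⟨hpos, hneg⟩ := integrable_add_measure.1 hf
  conv_lhs => rw [← s.toSignedMeasure_toJordanDecomposition, JordanDecomposition.toSignedMeasure]
  rw [VectorMeasure.integral_sub_vectorMeasure, VectorMeasure.integral_toSignedMeasure,
    VectorMeasure.integral_toSignedMeasure]
  · simpa [VectorMeasure.Integrable] using hpos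
  · simpa [VectorMeasure.Integrable] using hneg

theorem integral_complexMeasure_eq_re_add_im {μ : ComplexMeasure X} {f : X → ℂ}
    (hf : μ.Integrable f) :
    μ.integral f (mul ℝ ℂ) = (ComplexMeasure.re μ).integral f (lsmul ℝ ℝ).flip +
      Complex.I * (ComplexMeasure.im μ).integral f (lsmul ℝ ℝ).flip := by
  have hre : (ComplexMeasure.re μ).integral f (lsmul ℝ ℝ).flip = _ :=
    integral_mapRange hf Complex.reCLM (lsmul ℝ ℝ).flip
  have him : (ComplexMeasure.im μ).integral f (lsmul ℝ ℝ).flip = _ :=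
    integral_mapRange hf Complex.imCLM (lsmul ℝ ℝ).flip
  rw [hre, him, ← mul_apply' ℝ ℂ, VectorMeasure.continuousLinearMap_apply_integral hf,
    ← VectorMeasure.integral_add_cbm hf]
  congr 1
  ext x y
  change x * y = y.re * x + Complex.I * (y.im * x)
  linear_combination -x * Complex.re_add_im y

theorem isFiniteMeasure_variation_complexMeasure (μ : ComplexMeasure X) :
    IsFiniteMeasure μ.variation := by
  have h : μ.variation ≤
      (ComplexMeasure.re μ).totalVariation + (ComplexMeasure.im μ).totalVariation :=
    VectorMeasure.variation_le_of_forall_enorm_le fun A _ => calc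
      ‖μ A‖ₑ ≤ ‖ComplexMeasure.re μ A‖ₑ + ‖ComplexMeasure.im μ A‖ₑ := by
        rw [← ofReal_norm, ← ofReal_norm, ← ofReal_norm,
          ← ENNReal.ofReal_add (norm_nonneg _) (norm_nonneg _)]
        exact ENNReal.ofReal_le_ofReal (Complex.norm_le_abs_re_add_abs_im _)
      _ ≤ _ := add_le_add (SignedMeasure.enorm_le_totalVariation _ A)
        (SignedMeasure.enorm_le_totalVariation _ A)
  exact isFiniteMeasure_of_le _ h

theorem integrable_complexMeasure_of_norm_le {μ : ComplexMeasure X} {f : X → ℂ}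
    (hf : Measurable f) {c : ℝ} (hc : ∀ x, ‖f x‖ ≤ c) : μ.Integrable f :=
  have := isFiniteMeasure_variation_complexMeasure μ
  .of_bound hf.aestronglyMeasurable c (.of_forall hc)

end VectorMeasure

section CharFun

open Complex ComplexConjugate

variable {E : Type*} [NormedAddCommGroup E] [InnerProductSpace ℝ E] [MeasurableSpace E]

/-- The characteristic function `t ↦ ∫ exp (i ⟪x, t⟫) ds(x)` of a signed measure, the analogue of
`MeasureTheory.charFun`. -/
noncomputable def signedCharFun (s : SignedMeasure E) (t : E) : ℂ :=
  s.integral (fun x => exp (inner ℝ x t * I)) (ContinuousLinearMap.lsmul ℝ ℝ).flip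

variable [BorelSpace E] [SecondCountableTopology E]

theorem signedCharFun_eq_sub (s : SignedMeasure E) (t : E) :
    signedCharFun s t = charFun s.toJordanDecomposition.posPart t -
      charFun s.toJordanDecomposition.negPart t := by
  have : IsFiniteMeasure s.variation := s.totalVariation_eq_variation ▸ inferInstance
  simp only [charFun_apply]
  exact integral_signedMeasure_eq_sub s <| .of_bound (by fun_prop) 1 <|
    .of_forall fun x => (norm_exp_ofReal_mul_I _).le

theorem signedCharFun_neg (s : SignedMeasure E) (t : E) :
    signedCharFun s (-t) = conj (signedCharFun s t) := by
  simp only [signedCharFun_eq_sub, charFun_neg, map_sub]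

theorem eq_zero_of_signedCharFun_eq_zero [CompleteSpace E] {s : SignedMeasure E}
    (h : ∀ t, signedCharFun s t = 0) : s = 0 := by
  have hparts : s.toJordanDecomposition.posPart = s.toJordanDecomposition.negPart :=
    Measure.ext_of_charFun <| funext fun t => sub_eq_zero.1 <| signedCharFun_eq_sub s t ▸ h t
  rw [← s.toSignedMeasure_toJordanDecomposition, JordanDecomposition.toSignedMeasure, sub_eq_zero]
  congr 1

theorem eq_zero_of_integral_exp_eq_zero [CompleteSpace E] {μ : ComplexMeasure E}
    (h : ∀ t, μ.integral (fun x => exp (inner ℝ x t * I)) (.mul ℝ ℂ) = 0) : μ = 0 := by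
  have hsum (t : E) : signedCharFun (ComplexMeasure.re μ) t +
      I * signedCharFun (ComplexMeasure.im μ) t = 0 := by
    rw [← h t]
    exact (integral_complexMeasure_eq_re_add_im <| integrable_complexMeasure_of_norm_le
      (by fun_prop) fun x => (norm_exp_ofReal_mul_I _).le).symm
  -- Conjugating the identity at `-t` changes only the sign of `I`.
  have hdiff (t : E) : signedCharFun (ComplexMeasure.re μ) t -
      I * signedCharFun (ComplexMeasure.im μ) t = 0 := by
    simpa [signedCharFun_neg, ← sub_eq_add_neg] using congrArg conj (hsum (-t))
  have hre : ComplexMeasure.re μ = 0 := eq_zero_of_signedCharFun_eq_zero fun t => by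
    linear_combination (hsum t + hdiff t) / 2
  have him : ComplexMeasure.im μ = 0 := eq_zero_of_signedCharFun_eq_zero fun t => by
    simpa [hre, signedCharFun] using hsum t
  exact ComplexMeasure.equivSignedMeasure.injective (Prod.ext hre him)

end CharFun

section IntegralCLM

variable {K : Type*} [TopologicalSpace K] [CompactSpace K] [MeasurableSpace K] [BorelSpace K]

theorem integrable_continuousMap (ν : ComplexMeasure K) (f : C(K, ℂ)) : ν.Integrable f :=
  integrable_complexMeasure_of_norm_le f.continuous.measurable f.norm_coe_le_norm

/-- Integration against a complex measure as a continuous functional on `C(K, ℂ)`. -/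
noncomputable def integralCLM (ν : ComplexMeasure K) : C(K, ℂ) →L[ℂ] ℂ :=
  LinearMap.mkContinuous
    { toFun f := ν.integral f (.mul ℝ ℂ)
      map_add' f g :=
        VectorMeasure.integral_add (integrable_continuousMap ν f) (integrable_continuousMap ν g)
      map_smul' c f := by
        have hf := integrable_continuousMap ν f
        have h1 := VectorMeasure.integral_continuousLinearMap_comp
          (B := .mul ℝ ℂ) (C := .mul ℝ ℂ c) hf
        have h2 := VectorMeasure.continuousLinearMap_apply_integral
          (B := .mul ℝ ℂ) (C := .mul ℝ ℂ c) hf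
        refine h1.trans (.trans ?_ h2.symm)
        congr 1
        ext x y
        exact mul_assoc c x y }
    (‖ContinuousLinearMap.mul ℝ ℂ‖ * ν.variation.real Set.univ) fun f => by
      have := isFiniteMeasure_variation_complexMeasure ν
      rw [mul_comm, ← mul_assoc]
      exact VectorMeasure.norm_integral_le_of_norm_le_const (.of_forall f.norm_coe_le_norm)

theorem integral_restrict_eq_integralCLM {X : Type*} [TopologicalSpace X] [MeasurableSpace X]
    [BorelSpace X] (μ : ComplexMeasure X) {S : Set X} [CompactSpace S] (hS : MeasurableSet S)
    {f : X → ℂ} (F : C(S, ℂ)) (hF : ∀ w : S, f w = F w) :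
    (μ.restrict S).integral f (.mul ℝ ℂ) =
      integralCLM (comapEmbedding μ (.subtype_coe hS)) F := by
  have hrestrict := map_comapEmbedding μ (.subtype_coe hS)
  rw [Subtype.range_coe] at hrestrict
  rw [← hrestrict, (MeasurableEmbedding.subtype_coe hS).integral_map_vectorMeasure]
  exact congrArg (fun g => VectorMeasure.integral _ g _) (funext hF)

end IntegralCLM

section LinearFunctional

theorem map_smul_add_smul_pow {R A : Type*} [CommSemiring R] [CommSemiring A] [Algebra R A]
    (Λ : A →ₗ[R] R) (α β : R) (a b : A) (N : ℕ) :
    Λ ((α • a + β • b) ^ N) = ∑ i ∈ Finset.range (N + 1),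
      (α ^ i * β ^ (N - i) * N.choose i) * Λ (a ^ i * b ^ (N - i)) := by
  rw [add_pow, map_sum]
  refine Finset.sum_congr rfl fun i _ => ?_
  rw [smul_pow, smul_pow, smul_mul_smul_comm, smul_mul_assoc, map_smul, ← nsmul_eq_mul', map_nsmul,
    nsmul_eq_mul, smul_eq_mul]
  ring

variable {K A : Type*} [Field K]

theorem map_pow_mul_pow_eq_zero_of_infinite [CharZero K] [CommSemiring A] [Algebra K A]
    (Λ : A →ₗ[K] K) (a b : A) (j m : ℕ)
    (h : {v : K | Λ ((v • a + b) ^ (j + m)) = 0}.Infinite) : Λ (a ^ j * b ^ m) = 0 := by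
  let p : Polynomial K := ∑ i ∈ Finset.range (j + m + 1),
    Polynomial.monomial i ((j + m).choose i * Λ (a ^ i * b ^ (j + m - i)))
  have hp : p = 0 := by
    refine Polynomial.eq_zero_of_infinite_isRoot p (h.mono fun v hv => ?_)
    have heval : p.eval v = Λ ((v • a + (1 : K) • b) ^ (j + m)) := by
      rw [map_smul_add_smul_pow, Polynomial.eval_finsetSum]
      refine Finset.sum_congr rfl fun i _ => ?_
      rw [Polynomial.eval_monomial, one_pow]
      ring
    exact heval.trans ((one_smul K b).symm ▸ hv)
  have hcoeff : p.coeff j = (j + m).choose j * Λ (a ^ j * b ^ m) := by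
    simp [p, Polynomial.finsetSum_coeff, Polynomial.coeff_monomial]
  rw [hp, Polynomial.coeff_zero, eq_comm, mul_eq_zero] at hcoeff
  exact hcoeff.resolve_left (Nat.cast_ne_zero.2 (Nat.choose_pos le_self_add).ne')

theorem map_pow_mul_eq_zero_of_triangular [Semiring A] [Algebra K A]
    (Λ : A →ₗ[K] K) (x g : A) (c : ℕ → ℕ → K) (hc : ∀ k, c k k ≠ 0)
    (h : ∀ k, Λ ((∑ j ∈ Finset.range (k + 1), c k j • x ^ j) * g) = 0) (k : ℕ) :
    Λ (x ^ k * g) = 0 := by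
  induction k using Nat.strong_induction_on with
  | _ k ih =>
    have hlower : ∑ j ∈ Finset.range k, c k j • Λ (x ^ j * g) = 0 :=
      Finset.sum_eq_zero fun j hj => by rw [ih j (Finset.mem_range.1 hj), smul_zero]
    have hk := h k
    rw [Finset.sum_mul, map_sum] at hk
    simp only [smul_mul_assoc, map_smul] at hk
    rw [Finset.sum_range_succ, hlower, zero_add] at hk
    exact (smul_eq_zero.1 hk).resolve_left (hc k)

end LinearFunctional

section BanachAlgebra

open NormedSpace ComplexConjugate

section NormedRing

variable {A : Type*} [NormedRing A] [NormedAlgebra ℂ A] [CompleteSpace A] (Λ : A →L[ℂ] ℂ)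

theorem map_exp_mul_eq_zero_of_pow {x g : A} (h : ∀ N : ℕ, Λ (x ^ N * g) = 0) :
    Λ (exp x * g) = 0 := by
  have hsum := ((exp_series_hasSum_exp' (𝕂 := ℂ) x).mul_right g).mapL Λ
  simp only [smul_mul_assoc, map_smul, h, smul_zero] at hsum
  exact hsum.unique hasSum_zero

theorem map_pow_eq_zero_of_exp {x : A} (h : ∀ t : ℝ, Λ (exp ((t : ℂ) • x)) = 0) (N : ℕ) :
    Λ (x ^ N) = 0 := by
  have hderiv (N : ℕ) (t : ℝ) : Λ (x ^ N * exp ((t : ℂ) • x)) = 0 := by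
    induction N generalizing t with
    | zero => rw [pow_zero, one_mul, h]
    | succ N ih =>
      have hexp := (hasDerivAt_exp_smul_const' x (t : ℂ)).const_mul (x ^ N)
      have hzero : HasDerivAt (fun t : ℝ => Λ (x ^ N * exp ((t : ℂ) • x)))
          (Λ (x ^ N * (x * exp ((t : ℂ) • x)))) t :=
        (Λ.hasFDerivAt.comp_hasDerivAt (t : ℂ) hexp).comp_ofReal
      simp only [ih] at hzero
      rw [pow_succ, mul_assoc]
      exact hzero.unique (hasDerivAt_const t 0)
  simpa using hderiv N 0

end NormedRing

variable {A : Type*} [NormedCommRing A] [NormedAlgebra ℂ A] [CompleteSpace A] (Λ : A →L[ℂ] ℂ)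

theorem map_pow_mul_pow_eq_zero_of_exp {α β : ℂ} (hα : α ≠ 0) (hβ : β ≠ 0) {a b : A}
    (h : ∀ l : ℂ, Λ (exp ((l * α) • a + (conj l * β) • b)) = 0) (j m : ℕ) :
    Λ (a ^ j * b ^ m) = 0 := by
  have hpow (u : ℂ) (hu : ‖u‖ = 1) : Λ ((u ^ 2 • α • a + β • b) ^ (j + m)) = 0 := by
    have hunit : u * conj u = 1 := by rw [Complex.mul_conj', hu]; norm_num
    have hfactor : u ^ 2 • α • a + β • b = u • ((u * α) • a + (conj u * β) • b) := by
      rw [smul_add, smul_smul, smul_smul, smul_smul, ← mul_assoc u (conj u), hunit, one_mul, sq,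
        mul_assoc]
    rw [hfactor, smul_pow, map_smul, map_pow_eq_zero_of_exp Λ (fun t => ?_), smul_zero]
    rw [← h (t * u), smul_add, smul_smul, smul_smul, map_mul, Complex.conj_ofReal, mul_assoc,
      mul_assoc]
  have hcircle : Metric.sphere (0 : ℂ) 1 ⊆ {v | Λ ((v • α • a + β • b) ^ (j + m)) = 0} := by
    intro v hv
    obtain ⟨u, rfl⟩ : ∃ u : ℂ, u ^ 2 = v := IsAlgClosed.exists_pow_nat_eq v two_pos
    rw [mem_sphere_zero_iff_norm, norm_pow] at hv
    exact hpow u ((pow_eq_one_iff_of_nonneg (norm_nonneg u) two_ne_zero).1 hv)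
  have hinf : (Metric.sphere (0 : ℂ) 1).Infinite :=
    (isPreconnected_sphere (by simp) 0 1).infinite_of_nontrivial
      ⟨1, by simp, -1, by simp, by norm_num⟩
  have hmoment := map_pow_mul_pow_eq_zero_of_infinite (Λ : A →ₗ[ℂ] ℂ) (α • a) (β • b) j m
    (hinf.mono hcircle)
  rw [smul_pow, smul_pow, smul_mul_smul_comm, map_smul, smul_eq_zero] at hmoment
  exact hmoment.resolve_left (mul_ne_zero (pow_ne_zero j hα) (pow_ne_zero m hβ))

theorem map_exp_eq_zero_of_pow_mul_pow {a b : A} (h : ∀ j m : ℕ, Λ (a ^ j * b ^ m) = 0) (α β : ℂ) :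
    Λ (exp (α • a + β • b)) = 0 := by
  rw [← mul_one (exp _)]
  refine map_exp_mul_eq_zero_of_pow Λ fun N => ?_
  rw [mul_one]
  refine (map_smul_add_smul_pow (Λ : A →ₗ[ℂ] ℂ) α β a b N).trans (Finset.sum_eq_zero fun i _ => ?_)
  exact mul_eq_zero_of_right _ (h _ _)

end BanachAlgebra

section Coefficients

open MvPolynomial

variable {R A σ : Type*} [CommSemiring R] [CommSemiring A] [Algebra R A] (Λ : A →ₗ[R] R)

/-- The polynomial obtained by applying the linear functional `Λ` to every coefficient. -/
noncomputable def mapCoeffs : MvPolynomial σ A →ₗ[R] MvPolynomial σ R where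
  toFun p := AddMonoidAlgebra.map (Λ : A →+ R) p
  map_add' p q := by ext d; exact map_add Λ (p.coeff d) (q.coeff d)
  map_smul' c p := by ext d; exact map_smul Λ c (p.coeff d)

theorem coeff_mapCoeffs (p : MvPolynomial σ A) (d : σ →₀ ℕ) :
    (mapCoeffs Λ p).coeff d = Λ (p.coeff d) := rfl

theorem mapCoeffs_monomial (d : σ →₀ ℕ) (c : A) :
    mapCoeffs Λ (monomial d c) = monomial d (Λ c) := by
  classical
  ext e
  rw [coeff_mapCoeffs, coeff_monomial, coeff_monomial, apply_ite Λ, map_zero]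

theorem pderiv_mapCoeffs (i : σ) (p : MvPolynomial σ A) :
    pderiv i (mapCoeffs Λ p) = mapCoeffs Λ (pderiv i p) := by
  induction p using MvPolynomial.induction_on' with
  | monomial d c =>
    rw [mapCoeffs_monomial, pderiv_monomial, pderiv_monomial, mapCoeffs_monomial,
      ← nsmul_eq_mul', ← nsmul_eq_mul', map_nsmul Λ, map_nsmul]
  | add p q hp hq => simp only [map_add, hp, hq]

theorem eval_mapCoeffs (x : σ → R) (p : MvPolynomial σ A) :
    eval x (mapCoeffs Λ p) = Λ (eval (fun i => algebraMap R A (x i)) p) := by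
  induction p using MvPolynomial.induction_on' with
  | monomial d c =>
    simp only [mapCoeffs_monomial, eval_monomial, Finsupp.prod, ← map_pow, ← map_prod]
    rw [mul_comm c, ← Algebra.smul_def, map_smul, smul_eq_mul, mul_comm]
  | add p q hp hq => simp only [map_add, hp, hq]

theorem isHomogeneous_mapCoeffs {p : MvPolynomial σ A} {l : ℕ} (hp : p.IsHomogeneous l) :
    (mapCoeffs Λ p).IsHomogeneous l := fun d hd =>
  hp fun h => hd <| by rw [coeff_mapCoeffs, h, map_zero]

end Coefficients

section Pairing

open MvPolynomial

variable {A ι : Type*} [CommSemiring A] [Fintype ι] (a b : ι → A)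

/-- The polynomial `(∑ aᵢ zᵢ)ʲ (∑ bᵢ z̄ᵢ)ᵐ` in the variables `zᵢ` (`Sum.inl i`) and `z̄ᵢ`
(`Sum.inr i`). -/
noncomputable def pairingPoly (j m : ℕ) : MvPolynomial (ι ⊕ ι) A :=
  (∑ i, C (a i) * X (Sum.inl i)) ^ j * (∑ i, C (b i) * X (Sum.inr i)) ^ m

theorem isHomogeneous_pairingPoly (j m : ℕ) : (pairingPoly a b j m).IsHomogeneous (j + m) := by
  have hlinear (c : ι → A) (s : ι → ι ⊕ ι) : (∑ i, C (c i) * X (s i)).IsHomogeneous 1 :=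
    .sum _ _ _ fun i _ => isHomogeneous_C_mul_X (c i) (s i)
  simpa only [pairingPoly, one_mul] using
    ((hlinear a Sum.inl).pow j).mul ((hlinear b Sum.inr).pow m)

theorem sum_pderiv_pairingPoly (j m : ℕ) :
    ∑ i, pderiv (Sum.inl i) (pderiv (Sum.inr i) (pairingPoly a b j m)) =
      C (∑ i, a i * b i) * ((j * m : ℕ) • pairingPoly a b (j - 1) (m - 1)) := by
  classical
  have hself (c : ι → A) {s : ι → ι ⊕ ι} (hs : s.Injective) (i : ι) :
      pderiv (s i) (∑ k, C (c k) * X (s k)) = C (c i) := by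
    simp [pderiv_X, Pi.single_apply, hs.eq_iff]
  have hother (c : ι → A) {s : ι → ι ⊕ ι} {k : ι ⊕ ι} (hk : ∀ i, s i ≠ k) :
      pderiv k (∑ i, C (c i) * X (s i)) = 0 := by
    simp [pderiv_X, hk]
  rw [map_sum, Finset.sum_mul]
  refine Finset.sum_congr rfl fun i _ => ?_
  have hinr : pderiv (Sum.inr i) (pairingPoly a b j m) =
      C (m * b i) * pairingPoly a b j (m - 1) := by
    rw [pairingPoly, pderiv_mul, pderiv_pow, pderiv_pow, hother a fun _ => Sum.inl_ne_inr,
      hself b Sum.inr_injective, pairingPoly, map_mul, map_natCast]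
    ring
  have hinl : pderiv (Sum.inl i) (pairingPoly a b j (m - 1)) =
      C (j * a i) * pairingPoly a b (j - 1) (m - 1) := by
    rw [pairingPoly, pderiv_mul, pderiv_pow, pderiv_pow, hother b fun _ => Sum.inr_ne_inl,
      hself a Sum.inl_injective, pairingPoly, map_mul, map_natCast]
    ring
  rw [hinr, pderiv_C_mul, hinl, nsmul_eq_mul]
  simp only [map_mul, map_natCast, Nat.cast_mul]
  ring

end Pairing

section Moments

open MvPolynomial ComplexConjugate

variable {A : Type*} [CommSemiring A] [Algebra ℂ A] {n : ℕ} (a b : Fin n → A) (Λ : A →ₗ[ℂ] ℂ)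

theorem value_mapCoeffs_pairingPoly (j m : ℕ) (z : CSpace n) :
    ZPoly.value (mapCoeffs Λ (pairingPoly a b j m)) z =
      Λ ((∑ i, z i • a i) ^ j * (∑ i, conj (z i) • b i) ^ m) := by
  rw [ZPoly.value, eval_mapCoeffs]
  simp only [pairingPoly, map_mul, map_pow, map_sum, eval_C, eval_X, Sum.elim_inl, Sum.elim_inr,
    Algebra.smul_def, mul_comm]

theorem laplacian_mapCoeffs_pairingPoly {R : ℂ} (hR : ∑ i, a i * b i = algebraMap ℂ A R)
    (j m : ℕ) :
    ZPoly.laplacian (mapCoeffs Λ (pairingPoly a b j m)) =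
      (4 * R * (j * m : ℕ)) • mapCoeffs Λ (pairingPoly a b (j - 1) (m - 1)) := by
  have hsum : ∑ i, pderiv (Sum.inl i) (pderiv (Sum.inr i) (pairingPoly a b j m)) =
      (R * (j * m : ℕ)) • pairingPoly a b (j - 1) (m - 1) := by
    rw [sum_pderiv_pairingPoly, hR, ← algebraMap_eq,
      ← IsScalarTower.algebraMap_apply, ← Algebra.smul_def, mul_smul R, Nat.cast_smul_eq_nsmul]
  simp only [ZPoly.laplacian, pderiv_mapCoeffs]
  rw [← map_sum, hsum, map_smul, ← smul_eq_C_mul, smul_smul, mul_assoc]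

theorem moment_eq_zero_of_isNonHarmonic {S : Set (CSpace n)} (hS : IsNonHarmonic S)
    {R : ℂ} (hR : ∑ i, a i * b i = algebraMap ℂ A R)
    (h : ∀ z ∈ S, ∀ j m : ℕ, Λ ((∑ i, z i • a i) ^ j * (∑ i, conj (z i) • b i) ^ m) = 0)
    (z : CSpace n) (j m : ℕ) :
    Λ ((∑ i, z i • a i) ^ j * (∑ i, conj (z i) • b i) ^ m) = 0 := by
  suffices hP : ∀ m, mapCoeffs Λ (pairingPoly a b j m) = 0 by
    rw [← value_mapCoeffs_pairingPoly, hP, ZPoly.value, map_zero]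
  induction j with
  | zero | succ j ih =>
    intro m
    by_contra hne
    exact hS _ _
      { ne_zero := hne
        homogeneous := isHomogeneous_mapCoeffs Λ (isHomogeneous_pairingPoly a b _ m)
        harmonic := by simp [laplacian_mapCoeffs_pairingPoly a b Λ hR, *] }
      fun z hz => (value_mapCoeffs_pairingPoly a b Λ _ m z).trans (h z hz _ m)

end Moments

section Sphere

open Complex

variable {n : ℕ} {S : Set (CSpace n)}

/-- The function `w ↦ z · w̄` on `S`. -/
noncomputable def pairing (S : Set (CSpace n)) (z : CSpace n) : C(S, ℂ) :=
  ⟨fun w => inner ℂ (w : CSpace n) z, by fun_prop⟩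

/-- The coordinate function `w ↦ wᵢ` on `S`. -/
noncomputable def coordinate (S : Set (CSpace n)) (i : Fin n) : C(S, ℂ) :=
  ⟨fun w => (w : CSpace n) i, by fun_prop⟩

theorem pairing_smul (l : ℂ) (z : CSpace n) : pairing S (l • z) = l • pairing S z :=
  ContinuousMap.ext fun w => inner_smul_right (w : CSpace n) z l

theorem pairing_eq_sum (z : CSpace n) : pairing S z = ∑ i, z i • star (coordinate S i) := by
  ext w
  simp [pairing, coordinate, PiLp.inner_apply]

theorem sum_star_coordinate_mul_coordinate (r : ℝ) :
    ∑ i, star (coordinate (Metric.sphere (0 : CSpace n) r) i) * coordinate _ i =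
      algebraMap ℂ _ ((r : ℂ) ^ 2) := by
  ext w
  have hnorm : ((‖(w : CSpace n)‖ ^ 2 : ℝ) : ℂ) = ∑ i, ((‖(w : CSpace n) i‖ ^ 2 : ℝ) : ℂ) := by
    rw [EuclideanSpace.norm_sq_eq, ofReal_sum]
  rw [norm_eq_of_mem_sphere] at hnorm
  simpa [ContinuousMap.sum_apply, coordinate, conj_mul', eq_comm] using hnorm

theorem exp_continuousMap_apply {X : Type*} [TopologicalSpace X] [CompactSpace X] (f : C(X, ℂ))
    (x : X) : NormedSpace.exp f x = exp (f x) := by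
  rw [exp_eq_exp_ℂ]
  exact NormedSpace.map_exp (ContinuousMap.evalAlgHom ℂ ℂ x) (continuous_eval_const x) f

theorem imDot_eq_im_inner (z w : CSpace n) : imDot z w = (inner ℂ w z).im := rfl

/-- The kernel `φ_k^a(z - w) e^{(i/2) Im(z · w̄)}`, as a function of `w`, of the twisted convolution
with the Laguerre function `φ_k^a`. -/
noncomputable def twistedLaguerre (a k : ℕ) (z w : CSpace n) : ℂ :=
  laguerreFun a k (z - w) * exp (I / 2 * imDot z w)

/-- The function `w ↦ |z - w|² / 2` on `S`. -/
noncomputable def halfSqDist (S : Set (CSpace n)) (z : CSpace n) : C(S, ℂ) :=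
  ⟨fun w => ((‖z - w‖ ^ 2 / 2 : ℝ) : ℂ), by fun_prop⟩

/-- The factor `e^{-|z - w|²/4} e^{(i/2) Im(z · w̄)}` shared by all the kernels
`twistedLaguerre a k z`, as a function of `w` on `S`. -/
noncomputable def twistedGaussian (S : Set (CSpace n)) (z : CSpace n) : C(S, ℂ) :=
  ⟨fun w => (Real.exp (-‖z - w‖ ^ 2 / 4) : ℂ) * exp (I / 2 * imDot z w), by
    simp only [imDot_eq_im_inner]
    fun_prop⟩

theorem ofReal_laguerrePoly (a k : ℕ) (x : ℝ) :
    (laguerrePoly a k x : ℂ) = ∑ j ∈ Finset.range (k + 1),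
      ((a + k).choose (k - j) * (-1) ^ j / j.factorial : ℂ) * (x : ℂ) ^ j := by
  rw [laguerrePoly, ofReal_sum]
  refine Finset.sum_congr rfl fun j _ => ?_
  rw [neg_pow]
  push_cast
  ring

theorem twistedLaguerre_eq (a k : ℕ) (z : CSpace n) (w : S) :
    twistedLaguerre a k z w = ((∑ j ∈ Finset.range (k + 1),
      ((a + k).choose (k - j) * (-1) ^ j / j.factorial : ℂ) • halfSqDist S z ^ j) *
        twistedGaussian S z) w := by
  simp [twistedLaguerre, laguerreFun, ofReal_laguerrePoly, ContinuousMap.sum_apply, halfSqDist,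
    twistedGaussian, mul_assoc]

theorem exp_half_halfSqDist_mul_twistedGaussian [CompactSpace S] (z : CSpace n) :
    NormedSpace.exp ((1 / 2 : ℂ) • halfSqDist S z) * twistedGaussian S z =
      NormedSpace.exp ((1 / 4 : ℂ) • pairing S z + (-1 / 4 : ℂ) • star (pairing S z)) := by
  ext w
  simp only [ContinuousMap.mul_apply, exp_continuousMap_apply, ContinuousMap.add_apply,
    ContinuousMap.smul_apply, ContinuousMap.star_apply, halfSqDist, twistedGaussian, pairing,
    ContinuousMap.coe_mk, ofReal_exp, ← exp_add, imDot_eq_im_inner, im_eq_sub_conj, star_def,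
    smul_eq_mul]
  congr 1
  push_cast
  field_simp
  ring

theorem exp_inner_eq_exp_pairing [CompactSpace S] (z : CSpace n) (w : S) :
    exp ((inner ℂ (w : CSpace n) z).re * I) =
      NormedSpace.exp ((I / 2) • pairing S z + (I / 2) • star (pairing S z)) w := by
  simp only [exp_continuousMap_apply, ContinuousMap.add_apply, ContinuousMap.smul_apply,
    ContinuousMap.star_apply, pairing, ContinuousMap.coe_mk, smul_eq_mul, re_eq_add_conj, star_def]
  congr 1
  ring

end Sphere

section Functional

variable {n : ℕ}

theorem map_exp_pairing_eq_zero_of_laguerre {S : Set (CSpace n)} [CompactSpace S]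
    (Λ : C(S, ℂ) →L[ℂ] ℂ) (a : ℕ) (z : CSpace n)
    (h : ∀ k, Λ ((∑ j ∈ Finset.range (k + 1),
      ((a + k).choose (k - j) * (-1) ^ j / j.factorial : ℂ) • halfSqDist S z ^ j) *
        twistedGaussian S z) = 0) :
    Λ (NormedSpace.exp ((1 / 4 : ℂ) • pairing S z + (-1 / 4 : ℂ) • star (pairing S z))) = 0 := by
  have hpow : ∀ N, Λ (halfSqDist S z ^ N * twistedGaussian S z) = 0 :=
    map_pow_mul_eq_zero_of_triangular (Λ : C(S, ℂ) →ₗ[ℂ] ℂ) _ _ _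
      (fun k => by simp [Nat.factorial_ne_zero]) h
  rw [← exp_half_halfSqDist_mul_twistedGaussian]
  refine map_exp_mul_eq_zero_of_pow Λ fun N => ?_
  rw [smul_pow, smul_mul_assoc, map_smul, hpow, smul_zero]

theorem map_exp_pairing_eq_zero_of_isNonHarmonic {r : ℝ}
    [CompactSpace (Metric.sphere (0 : CSpace n) r)]
    (Λ : C(Metric.sphere (0 : CSpace n) r, ℂ) →L[ℂ] ℂ) {C : Set (CSpace n)} (hC : IsComplexCone C)
    (hCnh : IsNonHarmonic C) {α β : ℂ} (hα : α ≠ 0) (hβ : β ≠ 0)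
    (h : ∀ z ∈ C, Λ (NormedSpace.exp (α • pairing _ z + β • star (pairing _ z))) = 0)
    (γ δ : ℂ) (z : CSpace n) :
    Λ (NormedSpace.exp (γ • pairing _ z + δ • star (pairing _ z))) = 0 := by
  have hcone (z : CSpace n) (hz : z ∈ C) (j m : ℕ) :
      Λ (pairing _ z ^ j * star (pairing _ z) ^ m) = 0 := by
    refine map_pow_mul_pow_eq_zero_of_exp Λ hα hβ (fun l => ?_) j m
    have hscaled := h (l • z) (hC l z hz)
    rwa [pairing_smul, star_smul, smul_smul, smul_smul, mul_comm α, mul_comm β] at hscaled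
  refine map_exp_eq_zero_of_pow_mul_pow Λ (fun j m => ?_) γ δ
  simp only [pairing_eq_sum, star_sum, star_smul, star_star] at hcone ⊢
  exact moment_eq_zero_of_isNonHarmonic _ _ (Λ : _ →ₗ[ℂ] ℂ) hCnh
    (sum_star_coordinate_mul_coordinate r) hcone z j m

end Functional

end SpectralProjection

open SpectralProjection in
theorem theorem5p4_general {n : ℕ} (a : ℕ) {r : ℝ} {C : Set (CSpace n)}
    (hC : IsComplexCone C) (hCnh : IsNonHarmonic C) {μ : ComplexMeasure (CSpace n)}
    (hvanish : ∀ k : ℕ, ∀ z ∈ C, (μ.restrict (Metric.sphere 0 r)).integral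
      (twistedLaguerre a k z) (.mul ℝ ℂ) = 0) :
    μ.restrict (Metric.sphere 0 r) = 0 := by
  have : CompactSpace (Metric.sphere (0 : CSpace n) r) :=
    isCompact_iff_compactSpace.1 (isCompact_sphere 0 r)
  have hS : MeasurableSet (Metric.sphere (0 : CSpace n) r) := Metric.isClosed_sphere.measurableSet
  let Λ := integralCLM (comapEmbedding μ (.subtype_coe hS))
  have hcone : ∀ z ∈ C, Λ (NormedSpace.exp
      ((1 / 4 : ℂ) • pairing _ z + (-1 / 4 : ℂ) • star (pairing _ z))) = 0 := fun z hz =>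
    map_exp_pairing_eq_zero_of_laguerre Λ a z fun k =>
      (integral_restrict_eq_integralCLM μ hS _ (twistedLaguerre_eq a k z)).symm.trans
        (hvanish k z hz)
  have hall := map_exp_pairing_eq_zero_of_isNonHarmonic Λ hC hCnh (by norm_num) (by norm_num) hcone
  let _ : InnerProductSpace ℝ (CSpace n) := .complexToReal
  refine eq_zero_of_integral_exp_eq_zero fun z => ?_
  exact (integral_restrict_eq_integralCLM μ hS _ (exp_inner_eq_exp_pairing z)).trans
    (hall (Complex.I / 2) (Complex.I / 2) z)

theorem theorem5p4 (n : ℕ) (hn : 1 ≤ n) (r : ℝ) (hr : 0 < r)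
    (C : Set (SpectralProjection.CSpace n))
    (hC : SpectralProjection.IsComplexCone C)
    (hCnh : SpectralProjection.IsNonHarmonic C)
    (μ : MeasureTheory.ComplexMeasure (SpectralProjection.CSpace n))
    (hμ : SpectralProjection.MemX r μ)
    (hvanish : ∀ k : ℕ, ∀ z ∈ C, SpectralProjection.spectralProjection r k μ z = 0) :
    μ = 0 := by
  rw [← SpectralProjection.restrict_eq_self_of_supported μ
    Metric.isClosed_sphere.measurableSet hμ.supported]
  exact theorem5p4_general (n - 1) hC hCnh hvanish
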